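/- Let $d\ge 1$. Let $\mathcal T$ be a Bienaymé–Galton–Watson tree whose offspring law $\mu$ on $\{0,1,2,\dots\}$ has mean one (criticality) and a finite exponential moment ($\sum_n \mu(n)e^{\delta n}<\infty$ for some $\delta>0$). Let $\theta$ be a centered probability law on $\mathbb Z^d$ whose support is exactly the set of the $2d$ neighbours of the origin. Attach to the edges $e$ of $\mathcal T$ i.i.d. increments $X_e$ of law $\theta$, independent of $\mathcal T$, and for a vertex $u$ let $S_u=x+\sum_{e\in[\emptyset,u]}X_e$, the sum being over the edges of the path from the root $\emptyset$ to $u$; $\mathbb P_x$, $\mathbb E_x$ denote the law and the expectation of this branching random walk started from $x\in\mathbb Z^d$. For real $r>0$ let $B_r=\{z\in\mathbb Z^d:\|z\|<r\}$ (Euclidean norm), let $\partial B_r=\{z\notin B_r:\ \exists\, y\in B_r,\ \|y-z\|=1\}$ be its outer boundary, and let $$\eta_r=\{u\in\mathcal T:\ S_u\in\partial B_r\ \text{and}\ S_v\notin\partial B_r\ \text{for every strict ancestor } v \text{ of } u\}$$ be the set of vertices at which the walk is frozen on $\partial B_r$. Theorem 2. There exist positive constants $c$ and $\lambda_0$, depending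 only on the dimension $d$ and on the offspring law $\mu$, such that for every jump law $\theta$ as above, every $0\le\lambda\le\lambda_0$ and every real $r\ge 1$, $$\sup_{x\in B_r}\mathbb E_x\Big[\exp\Big(\lambda\frac{|\eta_r|}{r^2}\Big)\Big]\le\exp\Big(\frac{c\lambda}{r^2}\Big).$$ Moreover $\mathbb P_x(\eta_r\ne\emptyset)>0$ for every $x\in B_r$, $$\sup_{x\in B_r}\mathbb E_x\Big[\exp\Big(\lambda\frac{|\eta_r|}{r^2}\Big)\ \Big|\ \eta_r\neq\emptyset\Big]\le\exp(c\lambda),$$ and $$\sup_{x\in B_{r/2}}\mathbb E_x\Big[\exp\Big(\lambda\frac{|\eta_r|}{r^2}\Big)\Big]\le\exp\Big(\frac{\lambda+c\lambda^2}{r^2}\Big).$$ -/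

import Mathlib

open MeasureTheory ProbabilityTheory

namespace BRW

/-- The lattice `ℤ^d`. -/
abbrev Zd (d : ℕ) : Type := Fin d → ℤ

/-- The Euclidean norm of a lattice point. -/
noncomputable def eucNorm {d : ℕ} (z : Zd d) : ℝ :=
  ‖(WithLp.toLp 2 (fun i => (z i : ℝ)) : EuclideanSpace ℝ (Fin d))‖

/-- The open Euclidean ball `B_r = {z ∈ ℤ^d : ‖z‖ < r}`. -/
def ball (d : ℕ) (r : ℝ) : Set (Zd d) := {z | eucNorm z < r}

/-- The outer boundary: the points outside `Λ` that have a lattice neighbour in `Λ`. -/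
def outerBoundary {d : ℕ} (Λ : Set (Zd d)) : Set (Zd d) :=
  {z | z ∉ Λ ∧ ∃ y ∈ Λ, eucNorm (y - z) = 1}

/-- A critical offspring law: its mean is one. -/
def IsCritical (μ : PMF ℕ) : Prop := ∑' n : ℕ, μ n * (n : ENNReal) = 1

/-- The offspring law has a finite exponential moment. -/
def HasExpMoment (μ : PMF ℕ) : Prop :=
  ∃ δ : ℝ, 0 < δ ∧ ∑' n : ℕ, μ n * ENNReal.ofReal (Real.exp (δ * n)) ≠ ⊤

/-- The jump laws: centered, with support exactly the set of neighbours of the origin. -/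
structure IsJumpLaw {d : ℕ} (θ : PMF (Zd d)) : Prop where
  support_eq : θ.support = {z | eucNorm z = 1}
  centered : ∀ i : Fin d, ∑' z : Zd d, (θ z).toReal * (z i : ℝ) = 0

/-- Vertices of the Ulam–Harris tree: finite words, the empty word being the root and
`v ++ [i]` the `i`-th child of `v` (with `i = 0, 1, …`). The ancestors of `u`, with `u` itself,
are its prefixes `v <+: u`. -/
abbrev Word : Type := List ℕ

/-- A sample: each word `v` carries an offspring number `(ω v).1` and the increment `(ω v).2`
on the edge that leads to `v` from its parent (the increment at the root is never used). -/
abbrev Sample (d : ℕ) : Type := Word → ℕ × Zd d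

/-- All offspring numbers and increments are independent, with laws `μ` and `θ`. -/
noncomputable def law {d : ℕ} (μ : PMF ℕ) (θ : PMF (Zd d)) : Measure (Sample d) :=
  Measure.infinitePi (fun _ : Word => μ.toMeasure.prod θ.toMeasure)

/-- The Bienaymé–Galton–Watson tree. -/
def tree {d : ℕ} (ω : Sample d) : Set Word :=
  {u | ∀ (v : Word) (i : ℕ), (v ++ [i]) <+: u → i < (ω v).1}

/-- The position `S_u` of the walk started from `x`: `x` plus the sum of the increments along the
path from the root to `u`. -/
def pos {d : ℕ} (x : Zd d) (ω : Sample d) (u : Word) : Zd d :=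
  x + ∑ k ∈ Finset.range u.length, (ω (u.take (k + 1))).2

/-- `η(Λ)`: the vertices of the tree at which the walk started from `x` is in `Λ`
while it is outside `Λ` at all the strict ancestors. -/
def hitting {d : ℕ} (x : Zd d) (Λ : Set (Zd d)) (ω : Sample d) : Set Word :=
  {u | u ∈ tree ω ∧ pos x ω u ∈ Λ ∧ ∀ v : Word, v <+: u → v ≠ u → pos x ω v ∉ Λ}

/-- `η_r = η(∂B_r)`, for the walk started from `x`. -/
def eta {d : ℕ} (r : ℝ) (x : Zd d) (ω : Sample d) : Set Word :=
  hitting x (outerBoundary (ball d r)) ω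

/-- The event `η_r ≠ ∅`, for the walk started from `x`. -/
def hitEvent {d : ℕ} (r : ℝ) (x : Zd d) : Set (Sample d) := {ω | eta r x ω ≠ ∅}

/-- `exp(a |η_r|)`, for the walk started from `x`, with values in `[0, ∞]`. -/
noncomputable def expEta {d : ℕ} (a r : ℝ) (x : Zd d) (ω : Sample d) : ENNReal :=
  EReal.exp ((a : EReal) * (((eta r x ω).encard : ENNReal) : EReal))

end BRW

/-! Let `N_n` be the number of frozen vertices of generation at most `n`, and `u_n(x)` the mean of
`z ^ N_n` for the walk started from `x`. On `∂B_r` one has `u_n = z`. Elsewhere the branching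
property gives `u_{n+1}(x) = G(∑ θ(w) u_n(x + w))`, with `G` the offspring generating function
(`countGen_succ`). Criticality and the exponential moment give `G(1 + t) ≤ 1 + t + C t²` on both
sides of `t = 0` (`exists_genFun_le`). One step of the walk raises the mean of `|x|²` by exactly 1,
so averaging `A - B|x|²` costs `B`, which pays for the error `C t²`. As `G` is monotone, suitable
quadratic bounds on `u_n` pass from `n` to `n + 1`.

This is used twice. With `z = e^ε`, `ε = λ/r²`, it yields `1 + ε + O(ε² r²)` uniformly in `n`
(`countGen_exp_le`); monotone convergence then gives the two unconditional bounds. With `z = 0` it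
bounds the probability of not hitting and shows that hitting has probability at least `1/(36 C r²)`
(`le_law_hitEvent`). The conditional bound follows: the excess over 1 of the exponential moment is
at most `3ε`, and dividing it by this probability leaves `O(λ)`. -/

namespace BRW

/-! ### Recursive structure of the tree and truncated counts -/

section Tree

variable {d : ℕ}

/-- The sample carried by the subtree above the `i`-th child of the root. -/
def shift (i : ℕ) (ω : Sample d) : Sample d := fun v => ω (i :: v)

lemma nil_mem_tree (ω : Sample d) : ([] : Word) ∈ tree ω := by
  intro v i h
  simp at h

lemma cons_mem_tree {ω : Sample d} {i : ℕ} {u : Word} :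
    i :: u ∈ tree ω ↔ i < (ω []).1 ∧ u ∈ tree (shift i ω) := by
  constructor
  · intro h
    refine ⟨h [] i (by simp), fun v j hv => h (i :: v) j (by simpa using hv)⟩
  · rintro ⟨h0, h1⟩ v j hv
    cases v with
    | nil =>
      have : j = i := by simpa using hv
      simpa [this] using h0
    | cons k v =>
      simp only [List.cons_append, List.cons_prefix_cons] at hv
      obtain ⟨rfl, hv⟩ := hv
      exact h1 v j hv

@[simp] lemma pos_nil (x : Zd d) (ω : Sample d) : pos x ω [] = x := by simp [pos]

@[simp] lemma pos_cons (x : Zd d) (ω : Sample d) (i : ℕ) (u : Word) :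
    pos x ω (i :: u) = pos (x + (ω [i]).2) (shift i ω) u := by
  simp only [pos, List.length_cons, Finset.sum_range_succ', List.take_succ_cons, shift,
    List.take_zero]
  abel

lemma nil_mem_hitting {x : Zd d} {Λ : Set (Zd d)} {ω : Sample d} :
    [] ∈ hitting x Λ ω ↔ x ∈ Λ := by
  simp [hitting, nil_mem_tree]

lemma cons_mem_hitting {x : Zd d} {Λ : Set (Zd d)} {ω : Sample d} {i : ℕ} {u : Word} :
    i :: u ∈ hitting x Λ ω ↔
      x ∉ Λ ∧ i < (ω []).1 ∧ u ∈ hitting (x + (ω [i]).2) Λ (shift i ω) := by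
  simp only [hitting, Set.mem_ofPred_eq, cons_mem_tree, pos_cons]
  constructor
  · rintro ⟨⟨h1, h2⟩, h3, h4⟩
    refine ⟨by simpa using h4 [] (by simp) (by simp), h1, h2, h3, fun v hv hne => ?_⟩
    simpa using h4 (i :: v) (by simpa using hv) (by simpa using hne)
  · rintro ⟨h0, h1, h2, h3, h4⟩
    refine ⟨⟨h1, h2⟩, h3, fun v hv hne => ?_⟩
    cases v with
    | nil => simpa using h0
    | cons k v =>
      simp only [List.cons_prefix_cons] at hv
      obtain ⟨rfl, hv⟩ := hv
      rw [pos_cons]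
      exact h4 v hv (by simpa using hne)

open Classical in
/-- The number of vertices of `hitting x Λ ω` of generation at most `n`. -/
noncomputable def count (Λ : Set (Zd d)) : ℕ → Zd d → Sample d → ℕ
  | 0, x, _ => if x ∈ Λ then 1 else 0
  | n + 1, x, ω => if x ∈ Λ then 1 else
      -- The increment on the edge to child `i` sits at the root coordinate of the shifted sample.
      ∑ i ∈ Finset.range (ω []).1, count Λ n (x + (shift i ω []).2) (shift i ω)

lemma hitting_of_mem {x : Zd d} {Λ : Set (Zd d)} (ω : Sample d) (hx : x ∈ Λ) :
    hitting x Λ ω = {[]} := by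
  ext u
  cases u with
  | nil => simp [nil_mem_hitting, hx]
  | cons i u => simp [cons_mem_hitting, hx]

lemma encard_hitting_le (Λ : Set (Zd d)) (n : ℕ) (x : Zd d) (ω : Sample d) :
    ({u ∈ hitting x Λ ω | u.length ≤ n}).encard = count Λ n x ω := by
  induction n generalizing x ω with
  | zero =>
    by_cases hx : x ∈ Λ
    · have : {u ∈ hitting x Λ ω | u.length ≤ 0} = {[]} := by
        rw [hitting_of_mem ω hx]; ext u; simp +contextual
      rw [this]; simp [count, hx]
    · have : {u ∈ hitting x Λ ω | u.length ≤ 0} = ∅ := by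
        ext u
        simp only [nonpos_iff_eq_zero, List.length_eq_zero_iff, Set.mem_ofPred_eq,
          Set.mem_empty_iff_false, iff_false, not_and]
        rintro hu rfl
        exact hx (nil_mem_hitting.1 hu)
      rw [this]; simp [count, hx]
  | succ n ih =>
    by_cases hx : x ∈ Λ
    · have : {u ∈ hitting x Λ ω | u.length ≤ n + 1} = {[]} := by
        rw [hitting_of_mem ω hx]; ext u; simp +contextual
      rw [this]; simp [count, hx]
    · have : {u ∈ hitting x Λ ω | u.length ≤ n + 1} =
          ⋃ i ∈ Finset.range (ω []).1, (fun v : Word => i :: v) ''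
            {u ∈ hitting (x + (shift i ω []).2) Λ (shift i ω) | u.length ≤ n} := by
        ext u
        cases u with
        | nil => simp [nil_mem_hitting, hx]
        | cons i u =>
          simp [cons_mem_hitting, hx, shift]
          tauto
      rw [this, ← Finset.set_biUnion_coe, Set.Finite.encard_biUnion (Finset.finite_toSet _)]
      · simp only [count, hx, if_false]
        rw [finsum_mem_coe_finset]
        push_cast
        refine Finset.sum_congr rfl fun i _ => ?_
        rw [Function.Injective.encard_image (fun a b h => by simpa using h), ih]
      · intro i _ j _ hij
        rw [Function.onFun, Set.disjoint_left]
        rintro _ ⟨a, _, rfl⟩ ⟨b, _, hb⟩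
        exact hij (List.cons.inj hb).1.symm

lemma count_le_encard (Λ : Set (Zd d)) (n : ℕ) (x : Zd d) (ω : Sample d) :
    (count Λ n x ω : ℕ∞) ≤ (hitting x Λ ω).encard := by
  rw [← encard_hitting_le]
  exact Set.encard_le_encard (Set.sep_subset _ _)

lemma count_mono (Λ : Set (Zd d)) (x : Zd d) (ω : Sample d) :
    Monotone fun n => count Λ n x ω := by
  intro m n hmn
  have : (count Λ m x ω : ℕ∞) ≤ count Λ n x ω := by
    rw [← encard_hitting_le, ← encard_hitting_le]
    exact Set.encard_le_encard fun u hu => ⟨hu.1, hu.2.trans hmn⟩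
  exact_mod_cast this

lemma exists_le_count {Λ : Set (Zd d)} {x : Zd d} {ω : Sample d} {k : ℕ}
    (hk : (k : ℕ∞) ≤ (hitting x Λ ω).encard) : ∃ n, k ≤ count Λ n x ω := by
  obtain ⟨t, ht, htk⟩ := Set.exists_subset_encard_eq hk
  have hfin : t.Finite := Set.finite_of_encard_eq_coe htk
  refine ⟨hfin.toFinset.sup List.length, ?_⟩
  have : (k : ℕ∞) ≤ count Λ (hfin.toFinset.sup List.length) x ω := by
    rw [← htk, ← encard_hitting_le]
    refine Set.encard_le_encard fun u hu => ⟨ht hu, ?_⟩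
    exact Finset.le_sup (f := List.length) (hfin.mem_toFinset.2 hu)
  exact_mod_cast this

lemma hitting_eq_empty_iff {Λ : Set (Zd d)} {x : Zd d} {ω : Sample d} :
    hitting x Λ ω = ∅ ↔ ∀ n, count Λ n x ω = 0 := by
  rw [← Set.encard_eq_zero]
  constructor
  · intro h n
    have := count_le_encard Λ n x ω
    rw [h] at this
    exact_mod_cast nonpos_iff_eq_zero.1 this
  · intro h
    by_contra hne
    obtain ⟨n, hn⟩ := exists_le_count (k := 1) (Order.one_le_iff_pos.2 (pos_iff_ne_zero.2 hne))
    have := h n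
    omega

lemma exp_encard_le (Λ : Set (Zd d)) (x : Zd d) (ω : Sample d) {a : ℝ} (ha : 0 ≤ a) :
    EReal.exp ((a : EReal) * (((hitting x Λ ω).encard : ENNReal) : EReal)) ≤
      ⨆ n, ENNReal.ofReal (Real.exp a) ^ count Λ n x ω := by
  have key : ∀ k : ℕ, (k : ℕ∞) ≤ (hitting x Λ ω).encard →
      ENNReal.ofReal (Real.exp a) ^ k ≤ ⨆ n, ENNReal.ofReal (Real.exp a) ^ count Λ n x ω := by
    intro k hk
    obtain ⟨n, hn⟩ := exists_le_count hk
    refine le_trans ?_ (le_iSup _ n)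
    exact pow_le_pow_right₀ (by simpa using ha) hn
  -- For `a = 0` the convention `0 * ⊤ = 0` makes the left side 1 even if the set is infinite; for
  -- `a > 0` the powers of `e^a` are unbounded.
  rcases eq_or_lt_of_le ha with rfl | ha'
  · simp
  induction h : (hitting x Λ ω).encard using ENat.recTopCoe with
  | top =>
    refine le_of_le_of_eq le_top (Eq.symm ?_)
    refine ENNReal.eq_top_of_forall_nnreal_le ?_
    intro r
    have ht : Filter.Tendsto (fun k : ℕ => ENNReal.ofReal (Real.exp a) ^ k) Filter.atTop
        (nhds ⊤) := ENNReal.tendsto_pow_atTop_nhds_top_iff.2 (by simpa using ha')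
    obtain ⟨k, hk⟩ := (ht.eventually (lt_mem_nhds (ENNReal.coe_lt_top (r := r)))).exists
    exact hk.le.trans (key k (by simp [h]))
  | coe k =>
    refine le_trans (le_of_eq ?_) (key k (by simp [h]))
    have : ((a : EReal) * ((((k : ℕ∞) : ENNReal)) : EReal)) = ((k * a : ℝ) : EReal) := by
      rw [ENat.toENNReal_coe, ← ENNReal.ofReal_natCast,
        EReal.coe_ennreal_ofReal, max_eq_left (Nat.cast_nonneg k), mul_comm, EReal.coe_mul]
    rw [this, EReal.exp_coe, Real.exp_nat_mul, ENNReal.ofReal_pow (Real.exp_pos a).le]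

end Tree

/-! ### Independence of the subtrees above the root -/

section Independence

/-- Disjoint blocks of coordinates of a product measure are independent. -/
lemma iIndepFun_blocks {α ι : Type*} {κ : ι → Type*} {X : Type*} [MeasurableSpace X]
    (ν : Measure X) [IsProbabilityMeasure ν] (f : (Σ i, κ i) → α) (hf : Function.Injective f) :
    iIndepFun (fun i (ω : α → X) (j : κ i) => ω (f ⟨i, j⟩)) (Measure.infinitePi fun _ => ν) := by
  rw [iIndepFun_iff_map_fun_eq_infinitePi_map (by fun_prop)]
  have h1 : ∀ i, (Measure.infinitePi fun _ : α => ν).map (fun ω (j : κ i) => ω (f ⟨i, j⟩)) =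
      Measure.infinitePi fun _ => ν := fun i =>
    Measure.map_infinitePi_infinitePi_of_inj (P := fun _ : α => ν) (f := fun j : κ i => f ⟨i, j⟩)
      (fun a b h => by simpa using hf h)
  simp_rw [h1]
  rw [← Measure.infinitePi_map_piCurry (fun i (j : κ i) => ν),
    ← Measure.map_infinitePi_infinitePi_of_inj (P := fun _ : α => ν) hf,
    Measure.map_map (by fun_prop) (by fun_prop)]
  rfl

variable {d : ℕ} (μ : PMF ℕ) (θ : PMF (Zd d))

instance : IsProbabilityMeasure (law μ θ) := by unfold law; infer_instance

/-- The index types of the root and of the subtrees above its children. -/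
def Block : Option ℕ → Type
  | none => Unit
  | some _ => Word

/-- The words of a block. -/
def blockWord : (Σ i, Block i) → Word
  | ⟨none, _⟩ => []
  | ⟨some i, v⟩ => i :: (v : List ℕ)

lemma blockWord_injective : Function.Injective blockWord := by
  rintro ⟨_ | i, v⟩ ⟨_ | j, w⟩ h
  · rfl
  · cases h
  · cases h
  · obtain ⟨rfl, h2⟩ := List.cons.inj h
    have h2 : v = w := h2
    rw [h2]

@[fun_prop] lemma measurable_shift (i : ℕ) : Measurable (shift (d := d) i) := by
  unfold shift; fun_prop

lemma map_shift (i : ℕ) : (law μ θ).map (shift i) = law μ θ :=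
  Measure.map_infinitePi_infinitePi_of_inj (P := fun _ : Word => μ.toMeasure.prod θ.toMeasure)
    (f := fun v : Word => i :: v) (fun a b h => by simpa using h)

lemma law_root (a : ℕ × Zd d) : law μ θ {ω | ω [] = a} = μ a.1 * θ a.2 := by
  have h := Measure.infinitePi_map_eval (fun _ : Word => μ.toMeasure.prod θ.toMeasure) []
  have h2 : law μ θ {ω | ω [] = a} = (law μ θ).map (fun ω => ω []) {a} := by
    rw [Measure.map_apply (by fun_prop) (measurableSet_singleton a)]; rfl
  rw [h2, law, h, ← Set.singleton_prod_singleton, Measure.prod_prod,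
    PMF.toMeasure_apply_singleton _ _ (measurableSet_singleton _),
    PMF.toMeasure_apply_singleton _ _ (measurableSet_singleton _)]

/-- The branching property at the root. -/
lemma lintegral_mul_prod_shift (K : ℕ × Zd d → ENNReal) (G : ℕ × Zd d → Sample d → ENNReal)
    (hG : ∀ a, Measurable (G a)) :
    ∫⁻ ω, K (ω []) * ∏ i ∈ Finset.range (ω []).1, G (ω []) (shift i ω) ∂law μ θ =
      ∑' a : ℕ × Zd d, K a * (μ a.1 * θ a.2 * (∫⁻ ω, G a ω ∂law μ θ) ^ a.1) := by
  classical
  -- The root mark takes countably many values. Fixing it makes the number of factors deterministic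
  -- and lets `G` depend on the mark.
  have hsplit : ∀ ω : Sample d,
      K (ω []) * ∏ i ∈ Finset.range (ω []).1, G (ω []) (shift i ω) =
      ∑' a : ℕ × Zd d, K a * ({ω : Sample d | ω [] = a}.indicator 1 ω *
        ∏ i ∈ Finset.range a.1, G a (shift i ω)) := by
    intro ω
    rw [tsum_eq_single (ω [])]
    · simp
    · intro a ha
      simp [Ne.symm ha]
  have hms : ∀ a, MeasurableSet {ω : Sample d | ω [] = a} := fun a =>
    (measurable_pi_apply (X := fun _ : Word => ℕ × Zd d) []) (measurableSet_singleton a)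
  have hm : ∀ a, Measurable fun ω : Sample d => {ω : Sample d | ω [] = a}.indicator 1 ω *
      ∏ i ∈ Finset.range a.1, G a (shift i ω) := fun a =>
    (measurable_one.indicator (hms a)).mul
      (Finset.measurable_fun_prod _ fun i _ => (hG a).comp (measurable_shift i))
  simp_rw [hsplit]
  rw [lintegral_tsum fun a => ((hm a).const_mul _).aemeasurable]
  refine tsum_congr fun a => ?_
  rw [lintegral_const_mul _ (hm a)]
  congr 1
  -- The root block carries the indicator of the mark, the block of each child carries `G a`; these
  -- are independent.
  let φ : (i : Option ℕ) → (Block i → ℕ × Zd d) → ENNReal := fun i => match i with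
    | none => fun f => ({a} : Set (ℕ × Zd d)).indicator 1 (f ())
    | some _ => fun f => G a f
  have hφ : ∀ i, Measurable (φ i) := by
    rintro (_ | i)
    · exact (measurable_one.indicator (measurableSet_singleton a)).comp
        (measurable_pi_apply (X := fun _ : Unit => ℕ × Zd d) ())
    · exact hG a
  have hind := (iIndepFun_blocks (μ.toMeasure.prod θ.toMeasure) blockWord
    blockWord_injective).comp φ hφ
  have := lintegral_prod_eq_prod_lintegral_of_indepFun (Finset.insertNone (Finset.range a.1)) _
    hind (fun i => (hφ i).comp (by fun_prop))
  simp only [Finset.prod_insertNone] at this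
  refine Eq.trans this ?_
  have h0 : ∫⁻ ω : Sample d, φ none (fun j => ω (blockWord ⟨none, j⟩)) ∂law μ θ =
      μ a.1 * θ a.2 := by
    rw [← law_root, ← lintegral_indicator_one (hms a)]
    rfl
  have h1 : ∀ i, ∫⁻ ω : Sample d, φ (some i) (fun j => ω (blockWord ⟨some i, j⟩)) ∂law μ θ =
      ∫⁻ ω, G a ω ∂law μ θ := by
    intro i
    conv_rhs => rw [← map_shift μ θ i, lintegral_map (hG a) (measurable_shift i)]
    rfl
  calc _ = (μ a.1 * θ a.2) * ∏ _i ∈ Finset.range a.1, ∫⁻ ω, G a ω ∂law μ θ :=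
        congrArg₂ (· * ·) h0 (Finset.prod_congr rfl fun i _ => h1 i)
    _ = _ := by simp

end Independence

end BRW

namespace BRW

/-! ### Recursion for the generating functions -/

section Recursion

variable {d : ℕ}

lemma measurable_count_comp (Λ : Set (Zd d)) (n : ℕ) (y : Sample d → Zd d) (hy : Measurable y)
    (h : ∀ x, Measurable (count Λ n x)) : Measurable fun ω => count Λ n (y ω) ω := by
  have : Measurable fun p : Zd d × Sample d => count Λ n p.1 p.2 :=
    measurable_from_prod_countable_right h
  exact this.comp (hy.prodMk measurable_id)

@[fun_prop] lemma measurable_count (Λ : Set (Zd d)) (n : ℕ) (x : Zd d) :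
    Measurable (count Λ n x) := by
  induction n generalizing x with
  | zero => exact measurable_const
  | succ n ih =>
    by_cases hx : x ∈ Λ
    · have : count Λ (n + 1) x = fun _ => 1 := by ext ω; simp [count, hx]
      rw [this]; exact measurable_const
    · have : count Λ (n + 1) x = fun ω => (fun p : ℕ × Sample d => ∑ i ∈ Finset.range p.1,
          count Λ n (x + (shift i p.2 []).2) (shift i p.2)) ((ω []).1, ω) := by
        ext ω; simp [count, hx]
      rw [this]
      refine Measurable.comp (g := fun p : ℕ × Sample d => ∑ i ∈ Finset.range p.1,
          count Λ n (x + (shift i p.2 []).2) (shift i p.2))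
        (measurable_from_prod_countable_right fun k => ?_) (by fun_prop)
      change Measurable fun ω : Sample d => ∑ i ∈ Finset.range k,
        count Λ n (x + (shift i ω []).2) (shift i ω)
      refine Finset.measurable_fun_sum _ fun i _ => ?_
      exact (measurable_count_comp Λ n (fun ω => x + (ω []).2) (by fun_prop) ih).comp
        (measurable_shift i)

variable (μ : PMF ℕ) (θ : PMF (Zd d))

/-- The generating function of the offspring law. -/
noncomputable def genFun (s : ENNReal) : ENNReal := ∑' n, μ n * s ^ n

lemma genFun_mono : Monotone (genFun μ) := fun s t h =>
  ENNReal.tsum_le_tsum fun n => by gcongr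

/-- The generating function of the number of hitting vertices of generation at most `n`. -/
noncomputable def countGen (Λ : Set (Zd d)) (z : ENNReal) (n : ℕ) (x : Zd d) : ENNReal :=
  ∫⁻ ω, z ^ count Λ n x ω ∂law μ θ

open Classical in
lemma countGen_zero (Λ : Set (Zd d)) (z : ENNReal) (x : Zd d) :
    countGen μ θ Λ z 0 x = if x ∈ Λ then z else 1 := by
  by_cases hx : x ∈ Λ <;> simp [countGen, count, hx]

lemma countGen_of_mem {Λ : Set (Zd d)} (z : ENNReal) (n : ℕ) {x : Zd d} (hx : x ∈ Λ) :
    countGen μ θ Λ z n x = z := by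
  cases n <;> simp [countGen, count, hx]

lemma measurable_pow_count (Λ : Set (Zd d)) (z : ENNReal) (n : ℕ) (x : Zd d) :
    Measurable fun ω : Sample d => z ^ count Λ n (x + (ω []).2) ω :=
  (Measurable.of_discrete (f := fun k : ℕ => z ^ k)).comp
    (measurable_count_comp Λ n (fun ω => x + (ω []).2) (by fun_prop) (measurable_count Λ n))

lemma countGen_succ_aux {Λ : Set (Zd d)} (z : ENNReal) (n : ℕ) {x : Zd d} (hx : x ∉ Λ) :
    countGen μ θ Λ z (n + 1) x =
      genFun μ (∫⁻ ω, z ^ count Λ n (x + (ω []).2) ω ∂law μ θ) := by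
  have h := lintegral_mul_prod_shift μ θ 1 (fun _ ω => z ^ count Λ n (x + (ω []).2) ω)
    (fun _ => measurable_pow_count Λ z n x)
  simp only [countGen, count, hx, if_false]
  simp only [Pi.one_apply, one_mul] at h
  simp_rw [← Finset.prod_pow_eq_pow_sum]
  rw [h, ENNReal.tsum_prod', genFun]
  refine tsum_congr fun k => ?_
  simp_rw [mul_assoc, ENNReal.tsum_mul_left, ENNReal.tsum_mul_right, θ.tsum_coe, one_mul]

/-- The starting point is moved by the increment stored at the root, in the same coordinate as the
offspring number. The two are independent, and the branching identity with a mark-dependent `G`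
allows summing over both. -/
lemma lintegral_planted (Λ : Set (Zd d)) (z : ENNReal) (n : ℕ) (x : Zd d) :
    ∫⁻ ω, z ^ count Λ n (x + (ω []).2) ω ∂law μ θ =
      ∑' w, θ w * countGen μ θ Λ z n (x + w) := by
  classical
  cases n with
  | zero =>
    have h := lintegral_mul_prod_shift μ θ (fun a => if x + a.2 ∈ Λ then z else 1)
      (fun _ _ => 1) (fun _ => measurable_const)
    simp only [Finset.prod_const_one, mul_one, lintegral_const, measure_univ, one_pow] at h
    have h2 : ∀ ω : Sample d, z ^ count Λ 0 (x + (ω []).2) ω =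
        if x + (ω []).2 ∈ Λ then z else 1 := fun ω => by
      by_cases hx : x + (ω []).2 ∈ Λ <;> simp [count, hx]
    simp_rw [h2, h, countGen_zero]
    rw [ENNReal.tsum_prod', ENNReal.tsum_comm]
    refine tsum_congr fun w => ?_
    by_cases hx : x + w ∈ Λ <;>
      simp [hx, ENNReal.tsum_mul_left, ENNReal.tsum_mul_right, μ.tsum_coe, mul_comm]
  | succ n =>
    have h := lintegral_mul_prod_shift μ θ (fun a => if x + a.2 ∈ Λ then z else 1)
      (fun a ω => if x + a.2 ∈ Λ then 1 else z ^ count Λ n (x + a.2 + (ω []).2) ω)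
      (fun a => by
        by_cases hx : x + a.2 ∈ Λ
        · simp only [hx, if_true]; exact measurable_const
        · simp only [hx, if_false]; exact measurable_pow_count Λ z n _)
    have h2 : ∀ ω : Sample d, z ^ count Λ (n + 1) (x + (ω []).2) ω =
        (if x + (ω []).2 ∈ Λ then z else 1) * ∏ i ∈ Finset.range (ω []).1,
          if x + (ω []).2 ∈ Λ then 1 else
            z ^ count Λ n (x + (ω []).2 + (shift i ω []).2) (shift i ω) := fun ω => by
      by_cases hx : x + (ω []).2 ∈ Λ
      · simp [count, hx]
      · simp [count, hx, Finset.prod_pow_eq_pow_sum]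
    simp_rw [h2, h]
    rw [ENNReal.tsum_prod', ENNReal.tsum_comm]
    refine tsum_congr fun w => ?_
    dsimp only
    by_cases hx : x + w ∈ Λ
    · simp only [hx, if_true, lintegral_const, measure_univ, mul_one, one_pow,
        countGen_of_mem μ θ z (n + 1) hx]
      simp_rw [ENNReal.tsum_mul_left, ENNReal.tsum_mul_right, μ.tsum_coe, one_mul, mul_comm]
    · rw [countGen_succ_aux μ θ z n hx]
      simp only [hx, if_false, one_mul, genFun]
      rw [← ENNReal.tsum_mul_left]
      exact tsum_congr fun k => by ring

/-- The recursive equation for the generating functions of the truncated counts. -/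
lemma countGen_succ {Λ : Set (Zd d)} (z : ENNReal) (n : ℕ) {x : Zd d} (hx : x ∉ Λ) :
    countGen μ θ Λ z (n + 1) x = genFun μ (∑' w, θ w * countGen μ θ Λ z n (x + w)) := by
  rw [countGen_succ_aux μ θ z n hx, lintegral_planted]

end Recursion

/-! ### Second order expansion of the offspring generating function -/

section Offspring

/-- Compare with `e^{nt}` and expand to second order; half of the exponential `e^{δn}` absorbs `n²`,
the other half absorbs the remainder `e^{max(nt,0)}`. The linear term is kept exact because its mean
is fixed by criticality. -/
lemma one_add_pow_le {t : ℝ} (ht : -1 ≤ t) {δ : ℝ} (hδ : 0 < δ) (htδ : t ≤ δ / 2) (n : ℕ) :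
    (1 + t) ^ n ≤ 1 + n * t + 8 / δ ^ 2 * Real.exp (δ * n) * t ^ 2 := by
  have hn : (0 : ℝ) ≤ n := n.cast_nonneg
  have h1 : (1 + t) ^ n ≤ Real.exp (n * t) := by
    rw [Real.exp_nat_mul]
    exact pow_le_pow_left₀ (by linarith) (by linarith [Real.add_one_le_exp t]) n
  have h2 : ∀ y : ℝ, Real.exp y ≤ 1 + y + y ^ 2 * Real.exp (max y 0) := by
    intro y
    rcases le_total y 0 with hy | hy
    · rw [max_eq_right hy, Real.exp_zero, mul_one]
      rcases le_total (-1) y with h | h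
      · have := Real.abs_exp_sub_one_sub_id_le (abs_le.2 ⟨h, by linarith⟩)
        linarith [(abs_le.1 this).2]
      · have := Real.exp_le_one_iff.2 hy
        nlinarith
    · rw [max_eq_left hy]
      have := Real.one_sub_le_exp_neg y
      have h3 : Real.exp (-y) * Real.exp y = 1 := by rw [← Real.exp_add]; simp
      nlinarith [Real.exp_pos y, Real.add_one_le_exp y, mul_nonneg hy (Real.exp_pos y).le,
        mul_le_mul_of_nonneg_right this (Real.exp_pos y).le]
  have h3 : Real.exp (max (n * t) 0) ≤ Real.exp (δ / 2 * n) := by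
    apply Real.exp_le_exp.2
    apply max_le
    · nlinarith
    · positivity
  -- The constant comes from `y²/2 ≤ e^y` at `y = δn/2`.
  have h4 : (n : ℝ) ^ 2 ≤ 8 / δ ^ 2 * Real.exp (δ / 2 * n) := by
    have := Real.quadratic_le_exp_of_nonneg (x := δ / 2 * n) (by positivity)
    rw [div_mul_eq_mul_div, le_div_iff₀ (by positivity)]
    nlinarith [mul_nonneg hδ.le hn]
  have h5 : Real.exp (δ * n) = Real.exp (δ / 2 * n) * Real.exp (δ / 2 * n) := by
    rw [← Real.exp_add]; congr 1; ring
  calc (1 + t) ^ n ≤ 1 + n * t + (n * t) ^ 2 * Real.exp (max (n * t) 0) := h1.trans (h2 _)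
    _ ≤ 1 + n * t + (n * t) ^ 2 * Real.exp (δ / 2 * n) := by gcongr
    _ = 1 + n * t + n ^ 2 * Real.exp (δ / 2 * n) * t ^ 2 := by ring
    _ ≤ 1 + n * t + 8 / δ ^ 2 * Real.exp (δ / 2 * n) * Real.exp (δ / 2 * n) * t ^ 2 := by gcongr
    _ = _ := by rw [h5]; ring

/-- A second order bound at `1` for the generating function of a critical law. -/
lemma exists_genFun_le {μ : PMF ℕ} (hcrit : IsCritical μ) (hexp : HasExpMoment μ) :
    ∃ C t₀ : ℝ, 1 ≤ C ∧ 0 < t₀ ∧ ∀ t, -1 ≤ t → t ≤ t₀ →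
      genFun μ (ENNReal.ofReal (1 + t)) ≤ ENNReal.ofReal (1 + t + C * t ^ 2) := by
  obtain ⟨δ, hδ, hM⟩ := hexp
  have hfin : ∀ n, μ n ≠ ⊤ := fun n => μ.apply_ne_top n
  have hconv : ∀ f : ℕ → ℝ, (∀ n, 0 ≤ f n) → ∑' n, μ n * ENNReal.ofReal (f n) ≠ ⊤ →
      HasSum (fun n => (μ n).toReal * f n) (∑' n, μ n * ENNReal.ofReal (f n)).toReal := by
    intro f hf h
    have := ENNReal.hasSum_toReal h
    rw [← ENNReal.tsum_toReal_eq fun n => ENNReal.mul_ne_top (hfin n) ENNReal.ofReal_ne_top] at this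
    simpa only [ENNReal.toReal_mul, ENNReal.toReal_ofReal (hf _)] using this
  have hs0 : HasSum (fun n => (μ n).toReal) 1 := by
    have := ENNReal.hasSum_toReal μ.tsum_coe_ne_top
    rwa [← ENNReal.tsum_toReal_eq hfin, μ.tsum_coe, ENNReal.toReal_one] at this
  have hs1 : HasSum (fun n => (μ n).toReal * n) 1 := by
    have := hconv (fun n => n) (fun n => n.cast_nonneg)
    simp only [ENNReal.ofReal_natCast] at this
    rw [show ∑' n : ℕ, μ n * (n : ENNReal) = 1 from hcrit] at this
    simpa using this
  have hs2 := hconv (fun n => Real.exp (δ * n)) (fun n => (Real.exp_pos _).le) hM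
  set M := (∑' n, μ n * ENNReal.ofReal (Real.exp (δ * n))).toReal with hMdef
  refine ⟨max 1 (8 / δ ^ 2 * M), δ / 2, le_max_left _ _, by positivity, fun t ht1 ht2 => ?_⟩
  have hs : HasSum (fun n : ℕ => (μ n).toReal *
      (1 + n * t + 8 / δ ^ 2 * Real.exp (δ * n) * t ^ 2)) (1 + 1 * t + 8 / δ ^ 2 * t ^ 2 * M) := by
    have := (hs0.add (hs1.mul_right t)).add (hs2.mul_left (8 / δ ^ 2 * t ^ 2))
    convert this using 2
    ring
  have hle : ∀ n : ℕ, (μ n).toReal * (1 + t) ^ n ≤ (μ n).toReal *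
      (1 + n * t + 8 / δ ^ 2 * Real.exp (δ * n) * t ^ 2) := fun n =>
    mul_le_mul_of_nonneg_left (one_add_pow_le ht1 hδ ht2 n) ENNReal.toReal_nonneg
  have hnn : ∀ n : ℕ, 0 ≤ (μ n).toReal * (1 + t) ^ n := fun n =>
    mul_nonneg ENNReal.toReal_nonneg (pow_nonneg (by linarith) n)
  have hsum : Summable fun n : ℕ => (μ n).toReal * (1 + t) ^ n :=
    Summable.of_nonneg_of_le hnn hle hs.summable
  have heq : genFun μ (ENNReal.ofReal (1 + t)) =
      ENNReal.ofReal (∑' n : ℕ, (μ n).toReal * (1 + t) ^ n) := by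
    rw [ENNReal.ofReal_tsum_of_nonneg hnn hsum, genFun]
    refine tsum_congr fun n => ?_
    rw [ENNReal.ofReal_mul ENNReal.toReal_nonneg, ENNReal.ofReal_toReal (hfin n),
      ENNReal.ofReal_pow (by linarith)]
  rw [heq]
  apply ENNReal.ofReal_le_ofReal
  calc _ ≤ 1 + 1 * t + 8 / δ ^ 2 * t ^ 2 * M := hasSum_le hle hsum.hasSum hs
    _ ≤ _ := by nlinarith [le_max_right 1 (8 / δ ^ 2 * M), sq_nonneg t]

end Offspring

/-! ### Quadratic functions of the walk -/

section Walk

variable {d : ℕ}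

/-- The squared Euclidean norm. -/
def sqNorm (z : Zd d) : ℝ := ∑ i, (z i : ℝ) ^ 2

lemma sqNorm_nonneg (z : Zd d) : 0 ≤ sqNorm z := Finset.sum_nonneg fun _ _ => sq_nonneg _

lemma eucNorm_sq (z : Zd d) : eucNorm z ^ 2 = sqNorm z := by
  simp [eucNorm, EuclideanSpace.norm_sq_eq, sqNorm]

lemma eucNorm_nonneg (z : Zd d) : 0 ≤ eucNorm z := norm_nonneg _

lemma eucNorm_neg (z : Zd d) : eucNorm (-z) = eucNorm z := by
  rw [← sq_eq_sq₀ (eucNorm_nonneg _) (eucNorm_nonneg _), eucNorm_sq, eucNorm_sq]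
  simp [sqNorm]

lemma eucNorm_le_add (y z : Zd d) : eucNorm z ≤ eucNorm y + eucNorm (y - z) := by
  have h : (WithLp.toLp 2 (fun i => (z i : ℝ)) : EuclideanSpace ℝ (Fin d)) =
      WithLp.toLp 2 (fun i => (y i : ℝ)) - WithLp.toLp 2 (fun i => ((y - z) i : ℝ)) := by
    ext i; simp
  unfold eucNorm
  rw [h]
  exact norm_sub_le _ _

lemma sqNorm_lt_of_mem_ball {r : ℝ} {x : Zd d} (hx : x ∈ ball d r) : sqNorm x < r ^ 2 := by
  rw [← eucNorm_sq]
  exact pow_lt_pow_left₀ hx (eucNorm_nonneg x) two_ne_zero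

/-- A boundary point is at distance one from the ball, so its norm is below `r + 1 ≤ 2r`. -/
lemma sqNorm_le_of_mem {r : ℝ} (hr : 1 ≤ r) {x : Zd d}
    (hx : x ∈ ball d r ∪ outerBoundary (ball d r)) : sqNorm x ≤ 4 * r ^ 2 := by
  have : eucNorm x ≤ 2 * r := by
    rcases hx with hx | ⟨-, y, hy, hyx⟩
    · have : eucNorm x < r := hx
      linarith
    · have : eucNorm y < r := hy
      linarith [eucNorm_le_add y x]
  rw [← eucNorm_sq]
  nlinarith [eucNorm_nonneg x]

variable {θ : PMF (Zd d)}

lemma IsJumpLaw.eucNorm_eq (hθ : IsJumpLaw θ) {w : Zd d} (hw : θ w ≠ 0) : eucNorm w = 1 := by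
  have : w ∈ θ.support := hw
  rw [hθ.support_eq] at this
  exact this

lemma IsJumpLaw.add_mem (hθ : IsJumpLaw θ) {Λ : Set (Zd d)} {x w : Zd d} (hx : x ∈ Λ) (hw : θ w ≠ 0) :
    x + w ∈ Λ ∪ outerBoundary Λ := by
  by_cases h : x + w ∈ Λ
  · exact Or.inl h
  · exact Or.inr ⟨h, x, hx, by simpa [eucNorm_neg] using hθ.eucNorm_eq hw⟩

/-- Centering removes the cross term of `|x + w|²`, and every jump has length one. -/
lemma IsJumpLaw.hasSum_quadratic (hθ : IsJumpLaw θ) (A B : ℝ) (x : Zd d) :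
    HasSum (fun w => (θ w).toReal * (A - B * sqNorm (x + w))) (A - B * (sqNorm x + 1)) := by
  have hs0 : HasSum (fun w => (θ w).toReal) 1 := by
    have := ENNReal.hasSum_toReal θ.tsum_coe_ne_top
    rwa [← ENNReal.tsum_toReal_eq θ.apply_ne_top, θ.tsum_coe, ENNReal.toReal_one] at this
  have hsq : ∀ w, θ w ≠ 0 → sqNorm w = 1 := fun w hw => by
    rw [← eucNorm_sq, hθ.eucNorm_eq hw, one_pow]
  have hs1 : ∀ i, HasSum (fun w => (θ w).toReal * (w i : ℝ)) 0 := by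
    intro i
    rw [← hθ.centered i]
    refine Summable.hasSum (Summable.of_norm_bounded hs0.summable fun w => ?_)
    by_cases hw : θ w = 0
    · simp [hw]
    · rw [norm_mul, Real.norm_of_nonneg ENNReal.toReal_nonneg]
      refine mul_le_of_le_one_right ENNReal.toReal_nonneg ?_
      rw [Real.norm_eq_abs, ← sq_le_one_iff_abs_le_one, ← hsq w hw]
      exact Finset.single_le_sum (f := fun i => (w i : ℝ) ^ 2) (fun _ _ => sq_nonneg _)
        (Finset.mem_univ i)
  have hs2 := (hs0.mul_right (A - B * (sqNorm x + 1))).sub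
    ((hasSum_sum fun i (_ : i ∈ Finset.univ) => (hs1 i).mul_left (x i : ℝ)).mul_left (2 * B))
  simp only [mul_zero, Finset.sum_const_zero, sub_zero, one_mul] at hs2
  refine hs2.congr_fun fun w => ?_
  by_cases hw : θ w = 0
  · simp [hw]
  · have : sqNorm (x + w) = sqNorm x + sqNorm w + 2 * ∑ i, (x i : ℝ) * (w i : ℝ) := by
      simp only [sqNorm, Finset.mul_sum, ← Finset.sum_add_distrib]
      exact Finset.sum_congr rfl fun i _ => by push_cast [Pi.add_apply]; ring
    have h2 : ∑ i, (x i : ℝ) * ((θ w).toReal * (w i : ℝ)) =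
        (θ w).toReal * ∑ i, (x i : ℝ) * (w i : ℝ) := by
      rw [Finset.mul_sum]; exact Finset.sum_congr rfl fun i _ => by ring
    rw [this, hsq w hw, h2]
    ring

/-- Averaging a quadratic bound over one step of the walk. -/
lemma IsJumpLaw.tsum_le (hθ : IsJumpLaw θ) {Λ : Set (Zd d)} {g : Zd d → ENNReal} {A B : ℝ}
    (hnn : ∀ y ∈ Λ ∪ outerBoundary Λ, 0 ≤ A - B * sqNorm y)
    (hg : ∀ y ∈ Λ ∪ outerBoundary Λ, g y ≤ ENNReal.ofReal (A - B * sqNorm y))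
    {x : Zd d} (hx : x ∈ Λ) :
    0 ≤ A - B * (sqNorm x + 1) ∧
      ∑' w, θ w * g (x + w) ≤ ENNReal.ofReal (A - B * (sqNorm x + 1)) := by
  have hs := hθ.hasSum_quadratic A B x
  have h0 : ∀ w, 0 ≤ (θ w).toReal * (A - B * sqNorm (x + w)) := by
    intro w
    by_cases hw : θ w = 0
    · simp [hw]
    · exact mul_nonneg ENNReal.toReal_nonneg (hnn _ (hθ.add_mem hx hw))
  refine ⟨hs.nonneg h0, ?_⟩
  rw [← hs.tsum_eq, ENNReal.ofReal_tsum_of_nonneg h0 hs.summable]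
  refine ENNReal.tsum_le_tsum fun w => ?_
  by_cases hw : θ w = 0
  · simp [hw]
  · rw [ENNReal.ofReal_mul ENNReal.toReal_nonneg, ENNReal.ofReal_toReal (θ.apply_ne_top w)]
    gcongr
    exact hg _ (hθ.add_mem hx hw)

end Walk

end BRW

namespace BRW

/-! ### Quadratic supersolutions -/

section Comparison

variable {d : ℕ} {μ : PMF ℕ} {θ : PMF (Zd d)}

lemma countGen_succ_le (hθ : IsJumpLaw θ) {Λ : Set (Zd d)} {z : ENNReal} {n : ℕ} {A B : ℝ}
    (hnn : ∀ y ∈ Λ ∪ outerBoundary Λ, 0 ≤ A - B * sqNorm y)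
    (hg : ∀ y ∈ Λ ∪ outerBoundary Λ,
      countGen μ θ (outerBoundary Λ) z n y ≤ ENNReal.ofReal (A - B * sqNorm y))
    {x : Zd d} (hx : x ∈ Λ) :
    0 ≤ A - B * (sqNorm x + 1) ∧ countGen μ θ (outerBoundary Λ) z (n + 1) x ≤
      genFun μ (ENNReal.ofReal (A - B * (sqNorm x + 1))) := by
  have h := hθ.tsum_le hnn hg hx
  refine ⟨h.1, ?_⟩
  rw [countGen_succ μ θ z n (fun h : x ∈ outerBoundary Λ => h.1 hx)]
  exact genFun_mono μ h.2

lemma countGen_le_one {Λ : Set (Zd d)} {z : ENNReal} (hz : z ≤ 1) (n : ℕ) (x : Zd d) :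
    countGen μ θ Λ z n x ≤ 1 := by
  refine (lintegral_mono (g := fun _ => 1) fun ω => pow_le_one' hz _).trans ?_
  simp

/-- A quadratic supersolution bounds the exponential moments of the truncated counts. -/
lemma countGen_exp_le (hθ : IsJumpLaw θ) {C t₀ ε r : ℝ} (hC : 1 ≤ C)
    (hgen : ∀ t, -1 ≤ t → t ≤ t₀ →
      genFun μ (ENNReal.ofReal (1 + t)) ≤ ENNReal.ofReal (1 + t + C * t ^ 2))
    (hr : 1 ≤ r) (hε : 0 ≤ ε) (hε1 : ε ≤ 1) (hεt : 3 * ε ≤ t₀) (hεr : 36 * C * (ε * r ^ 2) ≤ 1)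
    (n : ℕ) {x : Zd d} (hx : x ∈ ball d r ∪ outerBoundary (ball d r)) :
    countGen μ θ (outerBoundary (ball d r)) (ENNReal.ofReal (Real.exp ε)) n x ≤
      ENNReal.ofReal (1 + ε + ε ^ 2 + 36 * C * ε ^ 2 * r ^ 2 - 9 * C * ε ^ 2 * sqNorm x) := by
  -- The curvature `9Cε² = C(3ε)²` pays for the second order term of `G`, as the argument stays
  -- below `1 + 3ε`. Since `|y|² ≤ 4r²`, the term `36Cε²r²` keeps the bound above `1 + ε + ε² ≥
  -- e^ε`, as the boundary value requires.
  have hb : 0 ≤ 9 * C * ε ^ 2 := by positivity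
  have hquad : ∀ y ∈ ball d r ∪ outerBoundary (ball d r), 1 + ε + ε ^ 2 ≤
      1 + ε + ε ^ 2 + 36 * C * ε ^ 2 * r ^ 2 - 9 * C * ε ^ 2 * sqNorm y := fun y hy => by
    have := mul_le_mul_of_nonneg_left (sqNorm_le_of_mem hr hy) hb
    linarith
  have hbd : ∀ y ∈ ball d r ∪ outerBoundary (ball d r), ENNReal.ofReal (Real.exp ε) ≤
      ENNReal.ofReal (1 + ε + ε ^ 2 + 36 * C * ε ^ 2 * r ^ 2 - 9 * C * ε ^ 2 * sqNorm y) :=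
    fun y hy => by
      refine ENNReal.ofReal_le_ofReal (le_trans ?_ (hquad y hy))
      have := Real.abs_exp_sub_one_sub_id_le (x := ε) (abs_le.2 ⟨by linarith, hε1⟩)
      linarith [(abs_le.1 this).2]
  induction n generalizing x with
  | zero =>
    rw [countGen_zero]
    split_ifs
    · exact hbd x hx
    · rw [← ENNReal.ofReal_one]
      exact ENNReal.ofReal_le_ofReal (le_trans (by nlinarith) (hquad x hx))
  | succ n ih =>
    rcases hx with hx | hx
    swap
    · rw [countGen_of_mem μ θ _ _ hx]
      exact hbd x (Or.inr hx)
    have h := countGen_succ_le hθ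
      (fun y hy => le_trans (by nlinarith) (hquad y hy)) (fun y hy => ih hy) hx
    refine h.2.trans ?_
    set s := sqNorm x with hs
    have hs0 : 0 ≤ s := sqNorm_nonneg x
    have hsr : s < r ^ 2 := sqNorm_lt_of_mem_ball hx
    set t := ε + ε ^ 2 + 36 * C * ε ^ 2 * r ^ 2 - 9 * C * ε ^ 2 * (s + 1) with ht
    have h1 : 1 + ε + ε ^ 2 + 36 * C * ε ^ 2 * r ^ 2 - 9 * C * ε ^ 2 * (s + 1) = 1 + t := by
      rw [ht]; ring
    have hr2 : 1 ≤ r ^ 2 := by nlinarith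
    have ht0 : 0 ≤ t := by
      have := mul_le_mul_of_nonneg_left (show s + 1 ≤ 4 * r ^ 2 by linarith) hb
      nlinarith
    have ht3 : t ≤ 3 * ε := by
      have h2 : 36 * C * ε ^ 2 * r ^ 2 ≤ ε := by nlinarith
      have h3 : 0 ≤ 9 * C * ε ^ 2 * (s + 1) := by positivity
      nlinarith
    have hCt : C * t ^ 2 ≤ 9 * C * ε ^ 2 := by
      have : t ^ 2 ≤ (3 * ε) ^ 2 := pow_le_pow_left₀ ht0 ht3 2
      nlinarith
    rw [h1]
    refine (hgen t (by linarith) (by linarith)).trans (ENNReal.ofReal_le_ofReal ?_)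
    linarith

/-- A quadratic bound for the probability that no vertex of generation at most `n` hits. -/
lemma countGen_zero_le (hθ : IsJumpLaw θ) {C t₀ r : ℝ} (hC : 1 ≤ C) (ht₀ : 0 < t₀)
    (hgen : ∀ t, -1 ≤ t → t ≤ t₀ →
      genFun μ (ENNReal.ofReal (1 + t)) ≤ ENNReal.ofReal (1 + t + C * t ^ 2))
    (hr : 1 ≤ r) {b L ρ : ℝ} (hb : b = 1 / (36 * C * r ^ 4)) (hL : L = 4 * r ^ 2 + 1)
    (hρ : ρ = 1 - 1 / L)
    (n : ℕ) {x : Zd d} (hx : x ∈ ball d r ∪ outerBoundary (ball d r)) :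
    countGen μ θ (outerBoundary (ball d r)) 0 n x ≤
      ENNReal.ofReal (1 - b * r ^ 2 + ρ ^ n * L - (b + ρ ^ n) * sqNorm x) := by
  -- The bound is the stationary profile `1 - b(r² + |x|²)` plus the transient `ρⁿ(L - |x|²)`. The
  -- transient is needed because `u_0 = 1` inside the ball; `L` exceeds every `|x|²` by at least
  -- one.
  have hr2 : 1 ≤ r ^ 2 := by nlinarith
  have hb0 : 0 < b := by rw [hb]; positivity
  have hbC : 36 * C * b * r ^ 4 = 1 := by rw [hb]; field_simp
  have hbr : 36 * b * r ^ 2 ≤ 1 := by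
    have h1 : 36 * b * r ^ 2 ≤ 36 * C * b * r ^ 4 := by
      calc 36 * b * r ^ 2 ≤ (36 * b * r ^ 2) * (C * r ^ 2) :=
            le_mul_of_one_le_right (by positivity) (by nlinarith)
        _ = _ := by ring
    linarith
  have hL0 : 0 < L := by rw [hL]; positivity
  have hρ0 : 0 ≤ ρ := by
    rw [hρ, sub_nonneg, div_le_one hL0, hL]; linarith
  have hρn : ∀ n, 0 ≤ ρ ^ n := fun n => pow_nonneg hρ0 n
  have hnn : ∀ n, ∀ y ∈ ball d r ∪ outerBoundary (ball d r),
      0 ≤ 1 - b * r ^ 2 + ρ ^ n * L - (b + ρ ^ n) * sqNorm y := fun n y hy => by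
    have h1 := sqNorm_le_of_mem hr hy
    have h2 : 0 ≤ ρ ^ n * (L - sqNorm y) := mul_nonneg (hρn n) (by linarith)
    nlinarith [mul_le_mul_of_nonneg_left h1 hb0.le]
  induction n generalizing x with
  | zero =>
    rw [countGen_zero]
    split_ifs
    · exact zero_le
    · rw [← ENNReal.ofReal_one]
      refine ENNReal.ofReal_le_ofReal ?_
      have h1 := sqNorm_le_of_mem hr hx
      rw [pow_zero]
      nlinarith [mul_le_mul_of_nonneg_left h1 hb0.le]
  | succ n ih =>
    rcases hx with hx | hx
    swap
    · rw [countGen_of_mem μ θ _ _ hx]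
      exact zero_le
    have h := countGen_succ_le hθ (hnn n) (fun y hy => ih hy) hx
    set s := sqNorm x with hs
    have hs0 : 0 ≤ s := sqNorm_nonneg x
    have hsr : s < r ^ 2 := sqNorm_lt_of_mem_ball hx
    -- The transient loses at least the factor `ρ` per step, since `(L - s)/L ≤ 1`.
    have hdec : ρ ^ n * (L - s - 1) ≤ ρ ^ (n + 1) * (L - s) := by
      rw [pow_succ, mul_assoc]
      refine mul_le_mul_of_nonneg_left ?_ (hρn n)
      have : (L - s) / L ≤ 1 := (div_le_one hL0).2 (by linarith)
      have h3 : ρ * (L - s) = L - s - (L - s) / L := by rw [hρ]; ring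
      linarith
    have hpos : 0 ≤ ρ ^ n * (L - s - 1) := mul_nonneg (hρn n) (by linarith)
    set t := ρ ^ n * (L - s - 1) - b * (r ^ 2 + s + 1) with ht
    have h1 : 1 - b * r ^ 2 + ρ ^ n * L - (b + ρ ^ n) * (s + 1) = 1 + t := by rw [ht]; ring
    rw [h1] at h
    -- If `t ≥ 0`, possibly beyond `t₀`, the target is at least `1 + t + b` and the trivial bound 1
    -- suffices. If `t ≤ 0`, then `|t| ≤ 6br²`, and the choice of `b` makes `C t² ≤ b`.
    rcases le_total 0 t with h0 | h0
    · refine (countGen_le_one zero_le_one _ _).trans ?_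
      rw [← ENNReal.ofReal_one]
      refine ENNReal.ofReal_le_ofReal ?_
      nlinarith
    · refine h.2.trans ((hgen t (by linarith [h.1]) (by linarith)).trans
        (ENNReal.ofReal_le_ofReal ?_))
      have hlow : -(6 * b * r ^ 2) ≤ t := by
        have := mul_le_mul_of_nonneg_left (show r ^ 2 + s + 1 ≤ 6 * r ^ 2 by linarith) hb0.le
        linarith
      have hsq : t ^ 2 ≤ (6 * b * r ^ 2) ^ 2 := by
        nlinarith
      have hCt : C * t ^ 2 ≤ b := by
        calc C * t ^ 2 ≤ C * (6 * b * r ^ 2) ^ 2 := by gcongr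
          _ = b * (36 * C * b * r ^ 4) := by ring
          _ = b := by rw [hbC, mul_one]
      linarith

end Comparison

/-! ### Hitting probability and conditional moments -/

section Moments

variable {d : ℕ} {μ : PMF ℕ} {θ : PMF (Zd d)}

lemma hitEvent_compl (r : ℝ) (x : Zd d) :
    (hitEvent r x)ᶜ = {ω | ∀ n, count (outerBoundary (ball d r)) n x ω = 0} := by
  ext ω
  simp [hitEvent, eta, hitting_eq_empty_iff]

lemma measurableSet_hitEvent (r : ℝ) (x : Zd d) : MeasurableSet (hitEvent r x) := by
  rw [← MeasurableSet.compl_iff, hitEvent_compl, Set.ofPred_forall]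
  exact MeasurableSet.iInter fun n =>
    measurable_count (outerBoundary (ball d r)) n x (measurableSet_singleton 0)

/-- Since `0 ^ 0 = 1`, the power `0 ^ count` is the indicator that nothing has hit by generation
`n`. -/
lemma law_hitEvent_compl_le (r : ℝ) (x : Zd d) (n : ℕ) :
    law μ θ (hitEvent r x)ᶜ ≤ countGen μ θ (outerBoundary (ball d r)) 0 n x := by
  rw [← lintegral_indicator_one (measurableSet_hitEvent r x).compl, countGen]
  refine lintegral_mono fun ω => ?_
  by_cases h : ω ∈ (hitEvent r x)ᶜ
  · rw [Set.indicator_of_mem h]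
    rw [hitEvent_compl] at h
    simp [h n]
  · simp [Set.indicator_of_notMem h]

/-- As `n → ∞` the transient vanishes and the non-hitting probability is at most `1 - b r²`. -/
lemma le_law_hitEvent (hθ : IsJumpLaw θ) {C t₀ r : ℝ} (hC : 1 ≤ C) (ht₀ : 0 < t₀)
    (hgen : ∀ t, -1 ≤ t → t ≤ t₀ →
      genFun μ (ENNReal.ofReal (1 + t)) ≤ ENNReal.ofReal (1 + t + C * t ^ 2))
    (hr : 1 ≤ r) {x : Zd d} (hx : x ∈ ball d r) :
    1 / (36 * C * r ^ 2) ≤ (law μ θ).real (hitEvent r x) := by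
  set b := 1 / (36 * C * r ^ 4) with hb
  set L := 4 * r ^ 2 + 1 with hL
  have hL1 : 1 ≤ L := by rw [hL]; nlinarith [sq_nonneg r]
  have hb0 : 0 < b := by positivity
  have hlim : Filter.Tendsto (fun n : ℕ => 1 - b * r ^ 2 + (1 - 1 / L) ^ n * L) Filter.atTop
      (nhds (1 - b * r ^ 2 + 0 * L)) := by
    refine tendsto_const_nhds.add (Filter.Tendsto.mul_const L ?_)
    refine tendsto_pow_atTop_nhds_zero_of_lt_one ?_ ?_
    · rw [sub_nonneg, div_le_one (by linarith)]; exact hL1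
    · have : 0 < 1 / L := by positivity
      linarith
  have hbound : ∀ n : ℕ, (law μ θ).real (hitEvent r x)ᶜ ≤
      1 - b * r ^ 2 + (1 - 1 / L) ^ n * L := by
    intro n
    have hρ : 0 ≤ (1 - 1 / L) ^ n := by
      refine pow_nonneg ?_ n
      rw [sub_nonneg, div_le_one (by linarith)]; exact hL1
    have h1 := (law_hitEvent_compl_le (μ := μ) (θ := θ) r x n).trans
      (countGen_zero_le hθ hC ht₀ hgen hr hb hL rfl n (Or.inl hx))
    have hle : 1 - b * r ^ 2 + (1 - 1 / L) ^ n * L - (b + (1 - 1 / L) ^ n) * sqNorm x ≤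
        1 - b * r ^ 2 + (1 - 1 / L) ^ n * L := by
      have := mul_nonneg (add_nonneg hb0.le hρ) (sqNorm_nonneg x)
      linarith
    have hbr : b * r ^ 2 ≤ 1 := by
      rw [hb, div_mul_eq_mul_div, one_mul, div_le_one (by positivity)]
      have : 1 ≤ r ^ 2 := by nlinarith
      calc r ^ 2 ≤ r ^ 2 * (36 * C * r ^ 2) :=
            le_mul_of_one_le_right (by positivity) (by nlinarith)
        _ = _ := by ring
    refine ENNReal.toReal_le_of_le_ofReal ?_ (h1.trans (ENNReal.ofReal_le_ofReal hle))
    have : 0 ≤ (1 - 1 / L) ^ n * L := by positivity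
    linarith
  have h := ge_of_tendsto' hlim hbound
  rw [probReal_compl_eq_one_sub (measurableSet_hitEvent r x)] at h
  have : b * r ^ 2 = 1 / (36 * C * r ^ 2) := by rw [hb]; field_simp
  linarith

lemma expEta_le_iSup {a : ℝ} (ha : 0 ≤ a) (r : ℝ) (x : Zd d) (ω : Sample d) :
    expEta a r x ω ≤
      ⨆ n, ENNReal.ofReal (Real.exp a) ^ count (outerBoundary (ball d r)) n x ω :=
  exp_encard_le _ x ω ha

lemma lintegral_iSup_pow_count {a : ℝ} (ha : 0 ≤ a) (Λ : Set (Zd d)) (x : Zd d) :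
    ∫⁻ ω, ⨆ n, ENNReal.ofReal (Real.exp a) ^ count Λ n x ω ∂law μ θ =
      ⨆ n, countGen μ θ Λ (ENNReal.ofReal (Real.exp a)) n x := by
  refine lintegral_iSup (fun n => ?_) fun m n hmn ω => ?_
  · exact (Measurable.of_discrete (f := fun k : ℕ => ENNReal.ofReal (Real.exp a) ^ k)).comp
      (measurable_count Λ n x)
  · exact pow_le_pow_right₀ (by simpa using ha) (count_mono Λ x ω hmn)

/-- Conditioning a functional that is at least one on the event that a vertex hits. -/
lemma lintegral_cond_le {Ω : Type*} [MeasurableSpace Ω] (P : Measure Ω) [IsProbabilityMeasure P]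
    {H : Set Ω} (hH : MeasurableSet H) {f : Ω → ENNReal} (hf : ∀ ω, 1 ≤ f ω) {a q : ℝ}
    (ha : 0 ≤ a) (hq : 0 < q) (hqH : q ≤ P.real H) (hint : ∫⁻ ω, f ω ∂P ≤ ENNReal.ofReal (1 + a)) :
    ∫⁻ ω, f ω ∂cond P H ≤ ENNReal.ofReal (1 + a / q) := by
  have hp : 0 < P.real H := hq.trans_le hqH
  -- Off `H` the functional already uses up mass `1 - P(H)`, so the whole excess `a` is left to `H`.
  have hcompl : ENNReal.ofReal (1 - P.real H) ≤ ∫⁻ ω in Hᶜ, f ω ∂P := by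
    rw [← probReal_compl_eq_one_sub hH, ofReal_measureReal, ← setLIntegral_one]
    exact lintegral_mono hf
  have hsum := lintegral_add_compl f hH (μ := P)
  have hle : ∫⁻ ω in H, f ω ∂P ≤ ENNReal.ofReal (P.real H + a) := by
    have h1 : ∫⁻ ω in H, f ω ∂P + ENNReal.ofReal (1 - P.real H) ≤
        ENNReal.ofReal (P.real H + a) + ENNReal.ofReal (1 - P.real H) := by
      rw [← ENNReal.ofReal_add (by positivity) (by linarith [measureReal_le_one (μ := P) (s := H)])]
      refine (add_le_add le_rfl hcompl).trans (hsum.le.trans (hint.trans ?_))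
      exact ENNReal.ofReal_le_ofReal (by linarith)
    exact (ENNReal.add_le_add_iff_right ENNReal.ofReal_ne_top).1 h1
  rw [ProbabilityTheory.cond, lintegral_smul_measure, smul_eq_mul,
    ← ofReal_measureReal (μ := P) (s := H), ← ENNReal.ofReal_inv_of_pos hp]
  refine (mul_le_mul_right hle _).trans ?_
  rw [← ENNReal.ofReal_mul (by positivity)]
  refine ENNReal.ofReal_le_ofReal ?_
  have h2 : (P.real H)⁻¹ * (P.real H + a) = 1 + a / P.real H := by field_simp
  rw [h2]
  gcongr

end Moments

end BRW

theorem theorem2 (d : ℕ) (hd : 1 ≤ d) (μ : PMF ℕ) (hcrit : BRW.IsCritical μ)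
    (hexp : BRW.HasExpMoment μ) :
    ∃ c lam0 : ℝ, 0 < c ∧ 0 < lam0 ∧
      ∀ θ : PMF (BRW.Zd d), BRW.IsJumpLaw θ →
      ∀ lam : ℝ, 0 ≤ lam → lam ≤ lam0 → ∀ r : ℝ, 1 ≤ r →
        (⨆ x ∈ BRW.ball d r, ∫⁻ ω, BRW.expEta (lam / r ^ 2) r x ω ∂(BRW.law μ θ))
            ≤ ENNReal.ofReal (Real.exp (c * lam / r ^ 2)) ∧
        (∀ x ∈ BRW.ball d r, 0 < BRW.law μ θ (BRW.hitEvent r x)) ∧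
        (⨆ x ∈ BRW.ball d r, ∫⁻ ω, BRW.expEta (lam / r ^ 2) r x ω
              ∂(ProbabilityTheory.cond (BRW.law μ θ) (BRW.hitEvent r x)))
            ≤ ENNReal.ofReal (Real.exp (c * lam)) ∧
        (⨆ x ∈ BRW.ball d (r / 2), ∫⁻ ω, BRW.expEta (lam / r ^ 2) r x ω ∂(BRW.law μ θ))
            ≤ ENNReal.ofReal (Real.exp ((lam + c * lam ^ 2) / r ^ 2)) := by
  obtain ⟨C, t₀, hC, ht₀, hgen⟩ := BRW.exists_genFun_le hcrit hexp
  -- The three caps on `λ ≥ ε` give `ε ≤ 1` (for `e^ε ≤ 1 + ε + ε²`), `3ε ≤ t₀`, and `36Cεr² = 36Cλ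
  -- ≤ 1`. The factor `108 = 3 · 36` combines `a ≤ 3ε` with the hitting probability.
  refine ⟨108 * C, min 1 (min (t₀ / 3) (1 / (36 * C))), by positivity, by positivity, ?_⟩
  intro θ hθ lam hlam hlam0 r hr
  simp only [le_min_iff] at hlam0
  obtain ⟨hl1, hl2, hl3⟩ := hlam0
  rw [le_div_iff₀ (by positivity)] at hl3
  have hr2 : 1 ≤ r ^ 2 := by nlinarith
  have hr0 : r ≠ 0 := by positivity
  set ε := lam / r ^ 2 with hεdef
  have hε : 0 ≤ ε := by positivity
  have hεlam : ε * r ^ 2 = lam := by rw [hεdef]; field_simp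
  have hεl : ε ≤ lam := div_le_self hlam hr2
  set a := ε + ε ^ 2 + 36 * C * ε ^ 2 * r ^ 2 with ha
  have ha0 : 0 ≤ a := by positivity
  have ha3 : a ≤ 3 * ε := by
    have h2 : 36 * C * ε ^ 2 * r ^ 2 ≤ ε := by
      calc 36 * C * ε ^ 2 * r ^ 2 = ε * (lam * (36 * C)) := by rw [← hεlam]; ring
        _ ≤ ε * 1 := by gcongr
        _ = ε := mul_one ε
    nlinarith
  have hsup : ∀ x ∈ BRW.ball d r,
      ∫⁻ ω, ⨆ n, ENNReal.ofReal (Real.exp ε) ^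
        BRW.count (BRW.outerBoundary (BRW.ball d r)) n x ω ∂(BRW.law μ θ) ≤
      ENNReal.ofReal (1 + a) := by
    intro x hx
    rw [BRW.lintegral_iSup_pow_count hε]
    refine iSup_le fun n => ?_
    refine (BRW.countGen_exp_le hθ hC hgen hr hε (hεl.trans hl1) (by linarith)
      (by rw [hεlam]; linarith) n (Or.inl hx)).trans (ENNReal.ofReal_le_ofReal ?_)
    have : 0 ≤ 9 * C * ε ^ 2 * BRW.sqNorm x := mul_nonneg (by positivity) (BRW.sqNorm_nonneg x)
    linarith
  have hmain : ∀ x ∈ BRW.ball d r,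
      ∫⁻ ω, BRW.expEta ε r x ω ∂(BRW.law μ θ) ≤ ENNReal.ofReal (1 + a) := fun x hx =>
    (lintegral_mono fun ω => BRW.expEta_le_iSup hε r x ω).trans (hsup x hx)
  have hhit : ∀ x ∈ BRW.ball d r,
      1 / (36 * C * r ^ 2) ≤ (BRW.law μ θ).real (BRW.hitEvent r x) := fun x hx =>
    BRW.le_law_hitEvent hθ hC ht₀ hgen hr hx
  refine ⟨iSup₂_le fun x hx => (hmain x hx).trans (ENNReal.ofReal_le_ofReal ?_), fun x hx => ?_,
    iSup₂_le fun x hx => ?_,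
    iSup₂_le fun x hx => (hmain x ?_).trans (ENNReal.ofReal_le_ofReal ?_)⟩
  · have : 108 * C * lam / r ^ 2 = 108 * C * ε := by rw [hεdef]; ring
    rw [this]
    refine le_trans ?_ (Real.add_one_le_exp _)
    nlinarith
  · have : 0 < (BRW.law μ θ).real (BRW.hitEvent r x) := lt_of_lt_of_le (by positivity) (hhit x hx)
    exact (ENNReal.toReal_pos_iff.1 this).1
  · refine (lintegral_mono fun ω => BRW.expEta_le_iSup hε r x ω).trans ?_
    refine (BRW.lintegral_cond_le _ (BRW.measurableSet_hitEvent r x) (fun ω => ?_) ha0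
      (by positivity) (hhit x hx) (hsup x hx)).trans (ENNReal.ofReal_le_ofReal ?_)
    -- The conditioning bound needs an integrand at least 1; the term `n = 0` suffices.
    · exact le_iSup_of_le 0 (one_le_pow₀ (by simpa using hε))
    · have h1 : a / (1 / (36 * C * r ^ 2)) ≤ 108 * C * lam := by
        rw [div_div_eq_mul_div, div_one, ← hεlam]
        calc a * (36 * C * r ^ 2) ≤ 3 * ε * (36 * C * r ^ 2) := by gcongr
          _ = _ := by ring
      linarith [Real.add_one_le_exp (108 * C * lam)]
  · have h : BRW.eucNorm x < r / 2 := hx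
    exact lt_of_lt_of_le h (by linarith)
  -- The coefficient of `ε` in `a` is exactly 1, and the rest is at most `37Cε²r²`.
  · have h1 : (lam + 108 * C * lam ^ 2) / r ^ 2 = ε + 108 * C * (ε ^ 2 * r ^ 2) := by
      rw [hεdef]; field_simp
    have h2 : ε ^ 2 ≤ ε ^ 2 * r ^ 2 := le_mul_of_one_le_right (sq_nonneg ε) hr2
    have h3 : ε ^ 2 * r ^ 2 ≤ C * (ε ^ 2 * r ^ 2) := le_mul_of_one_le_left (by positivity) hC
    rw [h1]
    refine le_trans ?_ (Real.add_one_le_exp _)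
    have h4 : 0 ≤ C * (ε ^ 2 * r ^ 2) := by positivity
    linarith
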